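/- Let $m,n\ge 0$ and let $\phi:\mathbb{R}^m\to GL(n,\mathbb{R})$ be a Lie group homomorphism which is semisimple as a representation (every $\phi(\mathbb{R}^m)$-invariant subspace of $\mathbb{R}^n$ has an invariant complement). Let $G=\mathbb{R}^m\ltimes_\phi\mathbb{R}^n$, with group law $(a,b)(c,d)=(a+c,\,b+\phi(a)d)$, and let $\mathfrak{g}$ be its Lie algebra. Suppose that $\dim[G,G]>\frac{\dim G}{2}$, that $G$ has a lattice $\Gamma$ (a discrete cocompact subgroup), that $J$ is a left-invariant complex structure on $G$, and that $b_1(G/\Gamma)=b_1(\mathfrak{g})$, where $G/\Gamma$ denotes the compact quotient manifold of $G$ by left translations by elements of $\Gamma$ (so that left-invariant tensors on $G$ descend to it), $b_1(G/\Gamma)=\dim H^1(G/\Gamma;\mathbb{R})$ is its first de Rham Betti number, and $b_1(\mathfrak{g})=\dim H^1(\mathfrak{g})$ is the dimension of the first cohomology of the complex $\bigwedge\mathfrak{g}^*$ of left-invariant forms on $G$. Then the compact complex manifold $(G/\Gamma,J)$ admits no Vaisman metric; that is, there is no smooth (not necessarily left-invariant) Hermitian metric $g$ on $(G/\Gamma,J)$,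 with fundamental form $\omega=g(-,J-)$ and Levi-Civita connection $\nabla$, for which there is a closed, non-exact $1$-form $\theta$ on $G/\Gamma$ (the Lee form) with $d\omega=\theta\wedge\omega$ and $\nabla\theta=0$. -/

import Mathlib

open scoped ContDiff

noncomputable section

namespace MetaAbelian

variable {m n : ℕ}

/-! ### The Lie group `ℝ^m ⋉_φ ℝ^n` -/

/-- The underlying manifold of `G = ℝ^m ⋉_φ ℝ^n`, i.e. the vector space `ℝ^m × ℝ^n`. Its additive
structure is used only as a global chart, so that all tangent spaces of `G` are identified
with `G` itself; the group structure of `G` is the multiplicative one defined below. -/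
def SemiProd (_φ : Representation ℝ (Multiplicative (Fin m → ℝ)) (Fin n → ℝ)) : Type :=
  (Fin m → ℝ) × (Fin n → ℝ)

namespace SemiProd

variable {φ : Representation ℝ (Multiplicative (Fin m → ℝ)) (Fin n → ℝ)}

instance : NormedAddCommGroup (SemiProd φ) :=
  inferInstanceAs (NormedAddCommGroup ((Fin m → ℝ) × (Fin n → ℝ)))

instance : NormedSpace ℝ (SemiProd φ) :=
  inferInstanceAs (NormedSpace ℝ ((Fin m → ℝ) × (Fin n → ℝ)))

instance : FiniteDimensional ℝ (SemiProd φ) :=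
  inferInstanceAs (FiniteDimensional ℝ ((Fin m → ℝ) × (Fin n → ℝ)))

@[ext]
theorem ext {p q : SemiProd φ} (h₁ : p.1 = q.1) (h₂ : p.2 = q.2) : p = q := Prod.ext h₁ h₂

theorem act_add (a c : Fin m → ℝ) (b : Fin n → ℝ) :
    φ (.ofAdd (a + c)) b = φ (.ofAdd a) (φ (.ofAdd c) b) := by
  rw [ofAdd_add, map_mul, Module.End.mul_apply]

theorem act_zero (b : Fin n → ℝ) : φ (.ofAdd 0) b = b := by
  rw [ofAdd_zero, map_one, Module.End.one_apply]

/-- The semidirect product group law `(a, b) (c, d) = (a + c, b + φ(a) d)`. -/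
instance : Group (SemiProd φ) where
  mul p q := (p.1 + q.1, p.2 + φ (.ofAdd p.1) q.2)
  one := ((0 : Fin m → ℝ), (0 : Fin n → ℝ))
  inv p := (-p.1, -φ (.ofAdd (-p.1)) p.2)
  mul_assoc p q r := by
    refine SemiProd.ext ?_ ?_
    · change p.1 + q.1 + r.1 = p.1 + (q.1 + r.1)
      exact add_assoc _ _ _
    · change p.2 + φ (.ofAdd p.1) q.2 + φ (.ofAdd (p.1 + q.1)) r.2
        = p.2 + φ (.ofAdd p.1) (q.2 + φ (.ofAdd q.1) r.2)
      rw [act_add, map_add, add_assoc]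
  one_mul p := by
    refine SemiProd.ext ?_ ?_
    · change 0 + p.1 = p.1
      exact zero_add _
    · change 0 + φ (.ofAdd 0) p.2 = p.2
      rw [act_zero, zero_add]
  mul_one p := by
    refine SemiProd.ext ?_ ?_
    · change p.1 + 0 = p.1
      exact add_zero _
    · change p.2 + φ (.ofAdd p.1) 0 = p.2
      rw [map_zero, add_zero]
  inv_mul_cancel p := by
    refine SemiProd.ext ?_ ?_
    · change -p.1 + p.1 = 0
      exact neg_add_cancel _
    · change -φ (.ofAdd (-p.1)) p.2 + φ (.ofAdd (-p.1)) p.2 = 0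
      exact neg_add_cancel _

theorem mul_fst (p q : SemiProd φ) : (p * q).1 = p.1 + q.1 := rfl

theorem mul_snd (p q : SemiProd φ) : (p * q).2 = p.2 + φ (.ofAdd p.1) q.2 := rfl

theorem inv_fst (p : SemiProd φ) : (p⁻¹).1 = -p.1 := rfl

theorem inv_snd (p : SemiProd φ) : (p⁻¹).2 = -φ (.ofAdd (-p.1)) p.2 := rfl

theorem commutator_fst (p q : SemiProd φ) : (p * q * p⁻¹ * q⁻¹).1 = 0 := by
  simp only [mul_fst, inv_fst]
  abel

theorem commutator_snd (p q : SemiProd φ) :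
    (p * q * p⁻¹ * q⁻¹).2 = p.2 + φ (.ofAdd p.1) q.2 - φ (.ofAdd q.1) p.2 - q.2 := by
  simp only [mul_fst, mul_snd, inv_fst, inv_snd, map_neg, ← act_add]
  have h₁ : p.1 + q.1 + -p.1 = q.1 := by abel
  have h₂ : p.1 + q.1 + -p.1 + -q.1 = 0 := by abel
  rw [h₂, h₁, act_zero]
  abel

theorem commutator_aux (r : ℝ) {p : SemiProd φ} (hp : p ∈ commutator (SemiProd φ)) :
    p.1 = 0 ∧ r • p ∈ commutator (SemiProd φ) := by
  rw [commutator_eq_closure] at hp ⊢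
  induction hp using Subgroup.closure_induction with
  | mem x hx =>
    obtain ⟨p, q, rfl⟩ := hx
    refine ⟨commutator_fst p q, Subgroup.subset_closure ?_⟩
    let p' : SemiProd φ := Prod.mk p.1 (r • p.2)
    let q' : SemiProd φ := Prod.mk q.1 (r • q.2)
    have key : p' * q' * p'⁻¹ * q'⁻¹ = r • (p * q * p⁻¹ * q⁻¹) := by
      refine SemiProd.ext ?_ ?_
      · rw [commutator_fst]
        change 0 = r • (p * q * p⁻¹ * q⁻¹).1
        rw [commutator_fst, smul_zero]
      · rw [commutator_snd]
        change r • p.2 + φ (.ofAdd p.1) (r • q.2) - φ (.ofAdd q.1) (r • p.2) - r • q.2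
          = r • (p * q * p⁻¹ * q⁻¹).2
        rw [commutator_snd]
        simp only [map_smul, smul_sub, smul_add]
    exact ⟨p', q', key⟩
  | one => exact ⟨rfl, by rw [show (r • (1 : SemiProd φ)) = 1 from smul_zero r]; exact one_mem _⟩
  | mul x y _ _ hx hy =>
    have hxy : x * y = x + y := by
      refine SemiProd.ext rfl ?_
      rw [mul_snd, hx.1, act_zero]
      rfl
    have hr : r • (x * y) = (r • x) * (r • y) := by
      refine SemiProd.ext ?_ ?_
      · exact smul_add r x.1 y.1
      · change r • (x * y).2 = r • x.2 + φ (.ofAdd (r • x.1)) (r • y.2)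
        rw [mul_snd, hx.1, smul_zero, act_zero, act_zero, smul_add]
    refine ⟨?_, ?_⟩
    · rw [mul_fst, hx.1, hy.1, add_zero]
    · rw [hr]
      exact mul_mem hx.2 hy.2
  | inv x _ hx =>
    have hr : r • x⁻¹ = (r • x)⁻¹ := by
      refine SemiProd.ext ?_ ?_
      · exact smul_neg r x.1
      · change r • (x⁻¹).2 = -φ (.ofAdd (-(r • x.1))) (r • x.2)
        rw [inv_snd, hx.1, smul_zero, neg_zero, act_zero, act_zero, smul_neg]
    refine ⟨?_, ?_⟩
    · rw [inv_fst, hx.1, neg_zero]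
    · rw [hr]
      exact inv_mem hx.2

/-- The commutator subgroup `[G, G]`; as a subset of `ℝ^m × ℝ^n` it is a linear subspace. -/
def commutatorSubspace (φ : Representation ℝ (Multiplicative (Fin m → ℝ)) (Fin n → ℝ)) :
    Submodule ℝ (SemiProd φ) where
  carrier := (commutator (SemiProd φ) : Set (SemiProd φ))
  zero_mem' := (commutator (SemiProd φ)).one_mem
  add_mem' := by
    intro x y hx hy
    have hxy : x + y = x * y := by
      refine SemiProd.ext rfl ?_
      rw [mul_snd, (commutator_aux 1 hx).1, act_zero]
      rfl
    rw [hxy]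
    exact mul_mem hx hy
  smul_mem' := fun r _ hx => (commutator_aux r hx).2

/-- The left translation `L_h : G → G`, `x ↦ h x`. -/
def leftMul (h x : SemiProd φ) : SemiProd φ := h * x

theorem contDiff_leftMul (h : SemiProd φ) {r : WithTop ℕ∞} : ContDiff ℝ r (leftMul h) := by
  have h₂ : ContDiff ℝ r (fun y : Fin n → ℝ => φ (.ofAdd h.1) y) :=
    (LinearMap.toContinuousLinearMap (φ (.ofAdd h.1))).contDiff
  exact (contDiff_const.add contDiff_fst : ContDiff ℝ r
      (fun x : (Fin m → ℝ) × (Fin n → ℝ) => h.1 + x.1)).prodMk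
    ((contDiff_const.add (h₂.comp contDiff_snd) : ContDiff ℝ r
      (fun x : (Fin m → ℝ) × (Fin n → ℝ) => h.2 + φ (.ofAdd h.1) x.2)))

/-- The differential `(dL_h)_x : T_x G → T_{hx} G` of the left translation by `h`. -/
def leftDeriv (h x : SemiProd φ) : SemiProd φ →L[ℝ] SemiProd φ := fderiv ℝ (leftMul h) x

/-! ### Lattices -/

/-- A lattice of `G` is a discrete cocompact subgroup. The quotient `G/Γ` on which
left-invariant objects of `G` live is the quotient of `G` by left translations by `Γ`. -/
structure IsLattice (Γ : Subgroup (SemiProd φ)) : Prop where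
  discrete : DiscreteTopology Γ
  cocompact : CompactSpace (MulAction.orbitRel.Quotient Γ (SemiProd φ))

/-! ### Differential forms on the quotient and left-invariant forms -/

/-- Not necessarily smooth real differential `k`-forms on `G`. -/
def Form (φ : Representation ℝ (Multiplicative (Fin m → ℝ)) (Fin n → ℝ)) (k : ℕ) : Type :=
  SemiProd φ → (SemiProd φ) [⋀^Fin k]→L[ℝ] ℝ

instance {k : ℕ} : AddCommGroup (Form φ k) :=
  inferInstanceAs (AddCommGroup (SemiProd φ → (SemiProd φ) [⋀^Fin k]→L[ℝ] ℝ))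

instance {k : ℕ} : Module ℝ (Form φ k) :=
  inferInstanceAs (Module ℝ (SemiProd φ → (SemiProd φ) [⋀^Fin k]→L[ℝ] ℝ))

/-- The smooth real `k`-forms on `G` which are invariant under left translations by the elements of
`Γ`. For a discrete `Γ` this is the space `A^k(G/Γ)` of differential forms on the quotient
manifold, through pull-back by the covering map `G → G/Γ`; for `Γ = G` (that is, `Γ = ⊤`) it is the
space `⋀^k 𝔤^*` of left-invariant forms. -/
def invForms (Γ : Subgroup (SemiProd φ)) (k : ℕ) : Submodule ℝ (Form φ k) where
  carrier := {α | ContDiff ℝ ∞ α ∧ ∀ γ ∈ Γ, ∀ x,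
    (α (γ * x)).compContinuousLinearMap (leftDeriv γ x) = α x}
  zero_mem' := ⟨contDiff_const, fun γ _ x => by ext v; rfl⟩
  add_mem' := by
    rintro α η ⟨hα, hα'⟩ ⟨hη, hη'⟩
    refine ⟨hα.add hη, fun γ hγ x => ?_⟩
    change (α (γ * x) + η (γ * x)).compContinuousLinearMap (leftDeriv γ x) = α x + η x
    rw [← hα' γ hγ x, ← hη' γ hγ x]
    ext v; rfl
  smul_mem' := by
    rintro c α ⟨hα, hα'⟩
    refine ⟨hα.const_smul c, fun γ hγ x => ?_⟩
    change (c • α (γ * x)).compContinuousLinearMap (leftDeriv γ x) = c • α x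
    rw [← hα' γ hγ x]
    ext v; rfl

theorem two_le_infty : (2 : WithTop ℕ∞) ≤ ∞ := WithTop.coe_le_coe.2 le_top

theorem contDiff_extDeriv {k : ℕ} {α : SemiProd φ → (SemiProd φ) [⋀^Fin k]→L[ℝ] ℝ}
    (hα : ContDiff ℝ ∞ α) : ContDiff ℝ ∞ (extDeriv α) := by
  have h : extDeriv α = fun x =>
      ContinuousAlternatingMap.alternatizeUncurryFinCLM ℝ (SemiProd φ) ℝ (fderiv ℝ α x) := by
    funext x
    rw [ContinuousAlternatingMap.alternatizeUncurryFinCLM_apply, extDeriv]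
  rw [h]
  exact (ContinuousLinearMap.contDiff _).comp (hα.fderiv_right (m := ∞) (by simp))

/-- The exterior differential `d : A^k → A^{k+1}` on `Γ`-invariant forms. -/
def invExtDeriv (Γ : Subgroup (SemiProd φ)) (k : ℕ) : invForms Γ k →ₗ[ℝ] invForms Γ (k + 1) where
  toFun α := ⟨extDeriv α.1, contDiff_extDeriv α.2.1, fun γ hγ x => by
    have key := extDeriv_pullback (𝕜 := ℝ) (r := ∞) (f := leftMul γ) (x := x)
      (α.2.1.differentiable (by simp) _) (contDiff_leftMul γ).contDiffAt
      (by simpa using two_le_infty)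
    have h : (fun y => (α.1 (leftMul γ y)).compContinuousLinearMap (fderiv ℝ (leftMul γ) y))
        = α.1 := funext fun y => α.2.2 γ hγ y
    rw [h] at key
    exact key.symm⟩
  map_add' α η := Subtype.ext <| funext fun x =>
    extDeriv_add (α.2.1.differentiable (by simp) x) (η.2.1.differentiable (by simp) x)
  map_smul' c α := Subtype.ext <| funext fun _ => extDeriv_smul c α.1

/-- The first Betti number of the complex of `Γ`-invariant forms, i.e. the dimension of
`ker (d : A^1 → A^2) / im (d : A^0 → A^1)`. For a lattice `Γ` it is `b_1(G/Γ) = dim H^1(G/Γ, ℝ)`,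
by de Rham cohomology; for `Γ = ⊤` it is `b_1(𝔤) = dim H^1(𝔤)`. -/
def bettiOne (Γ : Subgroup (SemiProd φ)) : ℕ :=
  Module.finrank ℝ (LinearMap.ker (invExtDeriv Γ 1) ⧸
    (LinearMap.range (invExtDeriv Γ 0)).submoduleOf (LinearMap.ker (invExtDeriv Γ 1)))

/-- The covector `v ↦ θ(v)` of an alternating form in one variable. -/
def toCovector {E : Type} [NormedAddCommGroup E] [NormedSpace ℝ E]
    (θ : E [⋀^Fin 1]→L[ℝ] ℝ) : E →L[ℝ] ℝ :=
  (ContinuousAlternatingMap.ofSubsingleton ℝ E ℝ (0 : Fin 1)).symm θ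

/-- The wedge product `θ ∧ ω` of a `1`-form and a `k`-form:
`(θ ∧ ω)(v_0, …, v_k) = ∑ i, (-1)^i θ(v_i) ω(v_0, …, v̂_i, …, v_k)`. -/
def wedgeOne {E : Type} [NormedAddCommGroup E] [NormedSpace ℝ E] {k : ℕ}
    (θ : E [⋀^Fin 1]→L[ℝ] ℝ) (α : E [⋀^Fin k]→L[ℝ] ℝ) : E [⋀^Fin (k + 1)]→L[ℝ] ℝ :=
  ContinuousAlternatingMap.alternatizeUncurryFin ((toCovector θ).smulRight α)

theorem wedgeOne_apply {E : Type} [NormedAddCommGroup E] [NormedSpace ℝ E] {k : ℕ}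
    (θ : E [⋀^Fin 1]→L[ℝ] ℝ) (α : E [⋀^Fin k]→L[ℝ] ℝ) (v : Fin (k + 1) → E) :
    wedgeOne θ α v = ∑ i : Fin (k + 1), (-1) ^ (i : ℕ) * (θ ![v i] * α (i.removeNth v)) := by
  rw [wedgeOne, ContinuousAlternatingMap.alternatizeUncurryFin_apply]
  refine Finset.sum_congr rfl fun i _ => ?_
  have h : toCovector θ (v i) = θ ![v i] := by
    change θ (fun _ => v i) = θ ![v i]
    congr 1
    funext j
    fin_cases j
    rfl
  simp [h]

/-! ### Left-invariant complex structures -/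

/-- A left-invariant complex structure on `G`: a left-invariant almost complex structure whose
Nijenhuis tensor `[JX, JY] - J[JX, Y] - J[X, JY] - [X, Y]` vanishes. -/
structure LeftInvariantComplexStructure
    (φ : Representation ℝ (Multiplicative (Fin m → ℝ)) (Fin n → ℝ)) where
  J : SemiProd φ → SemiProd φ →L[ℝ] SemiProd φ
  contDiff_J : ContDiff ℝ ∞ J
  J_J : ∀ x v, J x (J x v) = -v
  left_invariant : ∀ h x v, J (h * x) (leftDeriv h x v) = leftDeriv h x (J x v)
  integrable : ∀ X Y : SemiProd φ → SemiProd φ, ContDiff ℝ ∞ X → ContDiff ℝ ∞ Y → ∀ x,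
    VectorField.lieBracket ℝ (fun y => J y (X y)) (fun y => J y (Y y)) x
      - J x (VectorField.lieBracket ℝ (fun y => J y (X y)) Y x)
      - J x (VectorField.lieBracket ℝ X (fun y => J y (Y y)) x)
      - VectorField.lieBracket ℝ X Y x = 0

/-! ### Hermitian metrics on `(G/Γ, J)` and the Vaisman condition -/

/-- A (smooth, not necessarily left-invariant) Hermitian metric on `(G/Γ, J)`, given by its
pull-back to `G`, a Hermitian metric invariant under left translations by `Γ`. -/
structure HermitianMetric (Γ : Subgroup (SemiProd φ)) (J : LeftInvariantComplexStructure φ) where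
  g : SemiProd φ → SemiProd φ →L[ℝ] SemiProd φ →L[ℝ] ℝ
  contDiff_g : ContDiff ℝ ∞ g
  symm : ∀ x u v, g x u v = g x v u
  pos : ∀ x v, v ≠ 0 → 0 < g x v v
  hermitian : ∀ x u v, g x (J.J x u) (J.J x v) = g x u v
  invariant : ∀ γ ∈ Γ, ∀ x u v, g (γ * x) (leftDeriv γ x u) (leftDeriv γ x v) = g x u v

/-- The covector `½ (∂_u g(v, ·) + ∂_v g(u, ·) - ∂_· g(u, v))` of Christoffel symbols of the first
kind of a symmetric `2`-tensor `g` on `G` in the global chart. -/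
def christoffelLower (g : SemiProd φ → SemiProd φ →L[ℝ] SemiProd φ →L[ℝ] ℝ)
    (x u v : SemiProd φ) : SemiProd φ →L[ℝ] ℝ :=
  (1 / 2 : ℝ) • (fderiv ℝ g x u v + fderiv ℝ g x v u
    - ((ContinuousLinearMap.apply ℝ ℝ v).comp
        ((ContinuousLinearMap.apply ℝ (SemiProd φ →L[ℝ] ℝ) u).comp (fderiv ℝ g x))))

/-- The Levi-Civita connection `∇_X Y` of a Riemannian metric `g` on `G`, computed in the global
chart: `∇_X Y = D_X Y + g^{-1}(christoffelLower)`. -/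
def leviCivita (g : SemiProd φ → SemiProd φ →L[ℝ] SemiProd φ →L[ℝ] ℝ)
    (X Y : SemiProd φ → SemiProd φ) (x : SemiProd φ) : SemiProd φ :=
  fderiv ℝ Y x (X x) + (g x).inverse (christoffelLower g x (X x) (Y x))

theorem fderiv_metric_symm {g : SemiProd φ → SemiProd φ →L[ℝ] SemiProd φ →L[ℝ] ℝ}
    (hg : Differentiable ℝ g) (hs : ∀ x u v, g x u v = g x v u) (x w u v : SemiProd φ) :
    fderiv ℝ g x w u v = fderiv ℝ g x w v u := by
  have key : ∀ a b : SemiProd φ, HasFDerivAt (fun y => g y a b)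
      ((ContinuousLinearMap.apply ℝ ℝ b).comp
        ((ContinuousLinearMap.apply ℝ (SemiProd φ →L[ℝ] ℝ) a).comp (fderiv ℝ g x))) x := by
    intro a b
    have h := ((hg x).hasFDerivAt.clm_apply (hasFDerivAt_const a x)).clm_apply
      (hasFDerivAt_const b x)
    refine h.congr_fderiv ?_
    ext w
    simp
  have h := key u v
  rw [show (fun y => g y u v) = fun y => g y v u from funext fun y => hs y u v] at h
  exact DFunLike.congr_fun (h.unique (key v u)) w

theorem metric_inverse {B : SemiProd φ →L[ℝ] SemiProd φ →L[ℝ] ℝ}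
    (hp : ∀ v, v ≠ 0 → 0 < B v v) (ξ : SemiProd φ →L[ℝ] ℝ) : B (B.inverse ξ) = ξ := by
  have hinj : Function.Injective B := by
    rw [injective_iff_map_eq_zero]
    intro v hv
    by_contra hne
    have := hp v hne
    rw [hv] at this
    exact lt_irrefl _ this
  have hrank : Module.finrank ℝ (SemiProd φ) = Module.finrank ℝ (SemiProd φ →L[ℝ] ℝ) := by
    rw [← LinearEquiv.finrank_eq (LinearMap.toContinuousLinearMap :
      (SemiProd φ →ₗ[ℝ] ℝ) ≃ₗ[ℝ] (SemiProd φ →L[ℝ] ℝ))]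
    exact (Subspace.dual_finrank_eq).symm
  let e : SemiProd φ ≃L[ℝ] (SemiProd φ →L[ℝ] ℝ) :=
    (LinearEquiv.ofInjectiveOfFinrankEq B.toLinearMap hinj hrank).toContinuousLinearEquiv
  have he : B = (e : SemiProd φ →L[ℝ] (SemiProd φ →L[ℝ] ℝ)) := by
    ext u v
    rfl
  rw [he, ContinuousLinearMap.inverse_equiv]
  exact e.apply_symm_apply ξ

/-- `leviCivita` is torsion-free. -/
theorem leviCivita_torsion_free {g : SemiProd φ → SemiProd φ →L[ℝ] SemiProd φ →L[ℝ] ℝ}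
    (hg : Differentiable ℝ g) (hs : ∀ x u v, g x u v = g x v u) (X Y : SemiProd φ → SemiProd φ)
    (x : SemiProd φ) :
    leviCivita g X Y x - leviCivita g Y X x = VectorField.lieBracket ℝ X Y x := by
  have h : christoffelLower g x (X x) (Y x) = christoffelLower g x (Y x) (X x) := by
    ext w
    simp only [christoffelLower, smul_apply, sub_apply,
      add_apply, ContinuousLinearMap.comp_apply,
      ContinuousLinearMap.apply_apply, fderiv_metric_symm hg hs x w (X x) (Y x)]
    rw [add_comm]
  rw [leviCivita, leviCivita, h, VectorField.lieBracket]
  abel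

/-- `leviCivita` is compatible with the metric. -/
theorem leviCivita_metric {g : SemiProd φ → SemiProd φ →L[ℝ] SemiProd φ →L[ℝ] ℝ}
    (hg : Differentiable ℝ g) (hs : ∀ x u v, g x u v = g x v u) (hp : ∀ x v, v ≠ 0 → 0 < g x v v)
    (X : SemiProd φ → SemiProd φ) {Y Z : SemiProd φ → SemiProd φ} (hY : Differentiable ℝ Y)
    (hZ : Differentiable ℝ Z) (x : SemiProd φ) :
    fderiv ℝ (fun y => g y (Y y) (Z y)) x (X x)
      = g x (leviCivita g X Y x) (Z x) + g x (Y x) (leviCivita g X Z x) := by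
  have h := (((hg x).hasFDerivAt.clm_apply (hY x).hasFDerivAt).clm_apply (hZ x).hasFDerivAt).fderiv
  rw [h, leviCivita, leviCivita, map_add, map_add, hs x (Y x) ((g x).inverse _),
    add_apply, metric_inverse (hp x), metric_inverse (hp x)]
  simp only [christoffelLower, smul_apply, sub_apply,
    add_apply, ContinuousLinearMap.comp_apply,
    ContinuousLinearMap.apply_apply, ContinuousLinearMap.flip_apply, smul_eq_mul]
  rw [fderiv_metric_symm hg hs x (X x) (Z x) (Y x), fderiv_metric_symm hg hs x (Y x) (X x) (Z x),
    fderiv_metric_symm hg hs x (Z x) (X x) (Y x)]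
  ring

namespace HermitianMetric

variable {Γ : Subgroup (SemiProd φ)} {J : LeftInvariantComplexStructure φ}

/-- The fundamental form `ω(u, v) = g(u, J v)`. -/
def fundamentalForm (h : HermitianMetric Γ J) (x : SemiProd φ) : (SemiProd φ) [⋀^Fin 2]→L[ℝ] ℝ where
  toFun v := h.g x (v 0) (J.J x (v 1))
  map_update_add' := by
    intro _ v i a b
    fin_cases i <;> simp
  map_update_smul' := by
    intro _ v i c a
    fin_cases i <;> simp
  map_eq_zero_of_eq' := by
    intro v i j hv hij
    have hz : ∀ u, h.g x u (J.J x u) = 0 := by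
      intro u
      have h₁ := h.hermitian x u (J.J x u)
      rw [J.J_J, map_neg, h.symm x (J.J x u) u] at h₁
      linarith
    have h01 : v 0 = v 1 := by
      fin_cases i <;> fin_cases j
      · exact absurd rfl hij
      · exact hv
      · exact hv.symm
      · exact absurd rfl hij
    change h.g x (v 0) (J.J x (v 1)) = 0
    rw [← h01]
    exact hz _
  cont := by
    change Continuous fun v : Fin 2 → SemiProd φ => h.g x (v 0) (J.J x (v 1))
    fun_prop

/-- `θ` is a Lee form of the metric on `G/Γ`: a closed and non-exact `1`-form on `G/Γ`
with `dω = θ ∧ ω`. -/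
structure IsLeeForm (h : HermitianMetric Γ J) (θ : invForms Γ 1) : Prop where
  closed : invExtDeriv Γ 1 θ = 0
  not_exact : θ ∉ LinearMap.range (invExtDeriv Γ 0)
  extDeriv_eq : ∀ x, extDeriv h.fundamentalForm x = wedgeOne (θ.1 x) (h.fundamentalForm x)

/-- The metric on `G/Γ` is a Vaisman metric: it is locally conformal Kähler and its Lee form is
parallel for the Levi-Civita connection, `(∇_X θ)(Y) = X(θ(Y)) - θ(∇_X Y) = 0`. -/
def IsVaisman (h : HermitianMetric Γ J) : Prop :=
  ∃ θ : invForms Γ 1, h.IsLeeForm θ ∧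
    ∀ X Y : SemiProd φ → SemiProd φ, ContDiff ℝ ∞ X → ContDiff ℝ ∞ Y → ∀ x,
      fderiv ℝ (fun y => toCovector (θ.1 y) (Y y)) x (X x)
        - toCovector (θ.1 x) (leviCivita h.g X Y x) = 0

end HermitianMetric

end SemiProd

end MetaAbelian

end

/-!
The group `G` is metabelian, and its commutator `[G, G]` is a linear subspace of `ℝ^n` of dimension
more than `dim G / 2`. So `[𝔤, 𝔤]` contains a complex line `⟨v, J v⟩`
(`exists_mem_commutatorSubspace_J_mem`). This line exponentiates to a plane `P` in `[G, G]`, which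
is linear in the global chart and on which the left-invariant fields `v` and `J v` are constant; it
is a `J`-holomorphic curve.

Suppose that `θ` is the parallel Lee form of a Hermitian metric `g` on `G/Γ`, with fundamental form
`ω`. Three facts are combined.

* The number `c = |θ|²` is a positive constant (`HermitianMetric.IsParallel.norm_sq_eq`).
* Evaluating `dω = θ ∧ ω` on `(θ^♯, v, J v)` along `P` expresses the divergence of `θ` in `P`:
  `∂_v θ(v) + ∂_{Jv} θ(J v) = θ(v)² + θ(J v)² - c g(v, v)`
  (`HermitianMetric.IsParallel.fderiv_add_fderiv`).
* Since `b₁(G/Γ) = b₁(𝔤)`, one has `θ = θ₀ + df` with `θ₀` closed and left-invariant and `f` a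
  function on `G/Γ` (`IsLattice.exists_leftInvariant_cohomologous`); and `θ₀` vanishes on `[𝔤, 𝔤]`
  (`toCovector_commutatorSubspace`), so `θ = df` along `P`.

Hence the plane vector field `-e^{-f} (θ(v), θ(J v))` has divergence `e^{-f} c g(v, v)`. The
components of the field and this divergence come from continuous functions on the compact space
`G/Γ`, so the former are bounded and the latter is bounded below by a positive constant. The divergence
theorem on large squares forbids this (`not_forall_le_divergence`).
-/

noncomputable section

namespace MetaAbelian

/-! ### Plane vector fields of positive divergence -/

/-- A bounded `C¹` vector field on the plane cannot have divergence bounded below by a positive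
constant: on a square of side `T` the divergence contributes at least `ε T²`, while the flux
through the boundary is at most `4 M T`. -/
theorem not_forall_le_divergence {P Q : ℝ × ℝ → ℝ} (hP : ContDiff ℝ 1 P) (hQ : ContDiff ℝ 1 Q)
    {M ε : ℝ} (hε : 0 < ε) (hPM : ∀ z, |P z| ≤ M) (hQM : ∀ z, |Q z| ≤ M) :
    ¬ ∀ z, ε ≤ fderiv ℝ P z (1, 0) + fderiv ℝ Q z (0, 1) := by
  intro hdiv
  have hM : 0 ≤ M := (abs_nonneg _).trans (hPM 0)
  have hc : Continuous fun z => fderiv ℝ P z (1, 0) + fderiv ℝ Q z (0, 1) :=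
    ((hP.continuous_fderiv one_ne_zero).clm_apply continuous_const).add
      ((hQ.continuous_fderiv one_ne_zero).clm_apply continuous_const)
  -- `ε T² ≤ 4 M T` fails for this `T`
  obtain ⟨T, hT, hlarge⟩ : ∃ T : ℝ, 0 < T ∧ 4 * M < ε * T :=
    ⟨4 * M / ε + 1, by positivity, by
      rw [mul_add, mul_div_cancel₀ _ hε.ne']; linarith⟩
  have key := MeasureTheory.integral_divergence_prod_Icc_of_hasFDerivAt_of_le P Q
    (fderiv ℝ P) (fderiv ℝ Q) (0, 0) (T, T) ⟨hT.le, hT.le⟩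
    hP.continuous.continuousOn hQ.continuous.continuousOn
    (fun x _ => (hP.differentiable one_ne_zero x).hasFDerivAt)
    (fun x _ => (hQ.differentiable one_ne_zero x).hasFDerivAt)
    (hc.continuousOn.integrableOn_compact isCompact_Icc)
  have hvol : MeasureTheory.volume.real (Set.Icc ((0 : ℝ), (0 : ℝ)) (T, T)) = T * T := by
    rw [MeasureTheory.measureReal_def, ← Set.Icc_prod_Icc, MeasureTheory.Measure.volume_eq_prod,
      MeasureTheory.Measure.prod_prod]
    simp [hT.le]
  have hlow : ε * (T * T) ≤ ∫ z in Set.Icc ((0 : ℝ), (0 : ℝ)) (T, T),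
      fderiv ℝ P z (1, 0) + fderiv ℝ Q z (0, 1) := by
    rw [← hvol]
    exact MeasureTheory.setIntegral_ge_of_const_le_real measurableSet_Icc
      isCompact_Icc.measure_lt_top.ne (fun z _ => hdiv z)
      (hc.continuousOn.integrableOn_compact isCompact_Icc)
  have hside : ∀ F : ℝ → ℝ, (∀ s, |F s| ≤ M) → |∫ s in (0 : ℝ)..T, F s| ≤ M * T := by
    intro F hF
    have := intervalIntegral.norm_integral_le_of_norm_le_const (a := 0) (b := T) (f := F) (C := M)
      fun s _ => hF s
    simpa [abs_of_pos hT] using this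
  rw [key] at hlow
  have h₁ := abs_le.1 (hside (fun s => Q (s, T)) fun s => hQM _)
  have h₂ := abs_le.1 (hside (fun s => Q (s, 0)) fun s => hQM _)
  have h₃ := abs_le.1 (hside (fun s => P (T, s)) fun s => hPM _)
  have h₄ := abs_le.1 (hside (fun s => P (0, s)) fun s => hPM _)
  have : 4 * M * T < ε * T * T := mul_lt_mul_of_pos_right hlarge hT
  simp only at hlow
  linarith [h₁.2, h₂.1, h₃.2, h₄.1]

namespace SemiProd

/-! ### Differential forms of low degree -/

section Forms

variable {E : Type} [NormedAddCommGroup E] [NormedSpace ℝ E]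

theorem toCovector_apply (θ : E [⋀^Fin 1]→L[ℝ] ℝ) (w : Fin 1 → E) : θ w = toCovector θ (w 0) := by
  change θ w = θ fun _ => w 0
  congr 1
  funext j
  rw [Subsingleton.elim j 0]

theorem contDiff_toCovector {α : E → E [⋀^Fin 1]→L[ℝ] ℝ} {r : WithTop ℕ∞} (hα : ContDiff ℝ r α) :
    ContDiff ℝ r fun x => toCovector (α x) :=
  (ContinuousAlternatingMap.ofSubsingletonLIE (𝕜 := ℝ) (E := E) (F := ℝ)
    (0 : Fin 1)).symm.contDiff.comp hα

theorem extDeriv_oneForm_apply {α : E → E [⋀^Fin 1]→L[ℝ] ℝ} {x : E} (hα : ContDiff ℝ ∞ α)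
    (u v : E) :
    extDeriv α x ![u, v] = fderiv ℝ (fun y => toCovector (α y)) x u v
      - fderiv ℝ (fun y => toCovector (α y)) x v u := by
  have hd := (contDiff_toCovector hα).differentiable (by simp) x
  have h : ∀ w z : E, fderiv ℝ (fun y => toCovector (α y) w) x z
      = fderiv ℝ (fun y => toCovector (α y)) x z w := fun w z => by
    rw [fderiv_clm_apply hd (differentiableAt_const w)]
    simp
  rw [extDeriv_apply (hα.differentiable (by simp) x)]
  simp only [toCovector_apply, h]
  simp [Fin.removeNth]
  rfl

theorem extDeriv_zeroForm_apply {α : E → E [⋀^Fin 0]→L[ℝ] ℝ} {x : E} (hα : ContDiff ℝ ∞ α) (u : E) :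
    toCovector (extDeriv α x) u = fderiv ℝ (fun y => α y ![]) x u := by
  have h : toCovector (extDeriv α x) u = extDeriv α x ![u] := (toCovector_apply _ ![u]).symm
  rw [h, extDeriv_apply (hα.differentiable (by simp) x)]
  simp [Subsingleton.elim _ (![] : Fin 0 → E)]

end Forms

variable {m n : ℕ} {φ : Representation ℝ (Multiplicative (Fin m → ℝ)) (Fin n → ℝ)}

/-! ### Left translations -/

/-- The linear part `(u, v) ↦ (u, φ(a) v)` of the affine map `leftMul h`, where `a = h.1`. -/
def leftLinear (h : SemiProd φ) : SemiProd φ →L[ℝ] SemiProd φ :=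
  (ContinuousLinearMap.fst ℝ (Fin m → ℝ) (Fin n → ℝ)).prod
    ((LinearMap.toContinuousLinearMap (φ (.ofAdd h.1))).comp
      (ContinuousLinearMap.snd ℝ (Fin m → ℝ) (Fin n → ℝ)))

theorem hasFDerivAt_leftMul (h x : SemiProd φ) : HasFDerivAt (leftMul h) (leftLinear h) x := by
  have h₁ (x) : HasFDerivAt (fun x : (Fin m → ℝ) × (Fin n → ℝ) => h.1 + x.1)
      (ContinuousLinearMap.fst ℝ (Fin m → ℝ) (Fin n → ℝ)) x :=
    hasFDerivAt_fst.const_add _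
  have h₂ (x) : HasFDerivAt (fun x : (Fin m → ℝ) × (Fin n → ℝ) => h.2 + φ (.ofAdd h.1) x.2)
      ((LinearMap.toContinuousLinearMap (φ (.ofAdd h.1))).comp
        (ContinuousLinearMap.snd ℝ (Fin m → ℝ) (Fin n → ℝ))) x :=
    ((LinearMap.toContinuousLinearMap (φ (.ofAdd h.1))).hasFDerivAt.comp x
      hasFDerivAt_snd).const_add _
  exact (h₁ x).prodMk (h₂ x)

theorem leftDeriv_apply (h x v : SemiProd φ) :
    leftDeriv h x v = (v.1, φ (.ofAdd h.1) v.2) := by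
  rw [leftDeriv, (hasFDerivAt_leftMul h x).fderiv]
  rfl

theorem leftDeriv_mul (h p x y z v : SemiProd φ) :
    leftDeriv h y (leftDeriv p x v) = leftDeriv (h * p) z v := by
  rw [leftDeriv_apply, leftDeriv_apply, leftDeriv_apply, mul_fst]
  exact Prod.ext rfl (act_add _ _ _).symm

theorem leftDeriv_injective (h x : SemiProd φ) : Function.Injective (leftDeriv h x) := by
  rw [injective_iff_map_eq_zero]
  intro v hv
  have h₁ := leftDeriv_mul h⁻¹ h x x x v
  rw [hv, map_zero, inv_mul_cancel, leftDeriv_apply] at h₁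
  refine SemiProd.ext (congrArg Prod.fst h₁).symm ?_
  have h₂ := (congrArg Prod.snd h₁).symm
  exact (act_zero v.2).symm.trans h₂

theorem continuous_leftDeriv
    (hφ : ContDiff ℝ ∞ fun p : (Fin m → ℝ) × (Fin n → ℝ) => φ (.ofAdd p.1) p.2)
    (x v : SemiProd φ) : Continuous fun p : SemiProd φ => leftDeriv p x v := by
  simp only [leftDeriv_apply]
  have h : Continuous fun p : (Fin m → ℝ) × (Fin n → ℝ) => φ (.ofAdd p.1) v.2 :=
    hφ.continuous.comp (continuous_fst.prodMk continuous_const)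
  exact (continuous_const.prodMk h :
    Continuous fun p : (Fin m → ℝ) × (Fin n → ℝ) => (v.1, φ (.ofAdd p.1) v.2))

/-- A continuous function on `G/Γ` is bounded. -/
theorem IsLattice.exists_bound {Γ : Subgroup (SemiProd φ)} (hΓ : IsLattice Γ) {F : SemiProd φ → ℝ}
    (hF : Continuous F) (hinv : ∀ γ ∈ Γ, ∀ x, F (γ * x) = F x) : ∃ C, ∀ x, |F x| ≤ C := by
  have := hΓ.cocompact
  let F' : MulAction.orbitRel.Quotient Γ (SemiProd φ) → ℝ := Quotient.lift F (by
    rintro a b ⟨γ, rfl⟩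
    exact hinv γ.1 γ.2 b)
  have hF' : Continuous F' := hF.quotient_lift _
  obtain ⟨C, hC⟩ := (isCompact_range hF').isBounded.exists_norm_le
  exact ⟨C, fun x => hC _ ⟨Quotient.mk _ x, rfl⟩⟩

/-! ### Invariant forms of degree zero and one -/

section Invariant

variable {Γ : Subgroup (SemiProd φ)}

theorem toCovector_leftDeriv (θ : invForms Γ 1) {γ : SemiProd φ} (hγ : γ ∈ Γ) (x v : SemiProd φ) :
    toCovector (θ.1 (γ * x)) (leftDeriv γ x v) = toCovector (θ.1 x) v := by
  have h := θ.2.2 γ hγ x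
  exact DFunLike.congr_fun h fun _ => v

theorem fderiv_toCovector_symm {θ : invForms Γ 1} (hθ : invExtDeriv Γ 1 θ = 0)
    (x u v : SemiProd φ) : fderiv ℝ (fun y => toCovector (θ.1 y)) x u v
      = fderiv ℝ (fun y => toCovector (θ.1 y)) x v u := by
  have h : extDeriv θ.1 x = 0 := congrFun (congrArg Subtype.val hθ) x
  have h' := extDeriv_oneForm_apply (x := x) θ.2.1 u v
  rw [h] at h'
  exact (sub_eq_zero.1 h'.symm)

/-- The function on `G` underlying an invariant `0`-form. -/
def zeroFormFun (α : invForms Γ 0) (x : SemiProd φ) : ℝ := α.1 x ![]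

theorem contDiff_zeroFormFun (α : invForms Γ 0) : ContDiff ℝ ∞ (zeroFormFun α) :=
  (ContinuousAlternatingMap.apply ℝ (SemiProd φ) ℝ (![] : Fin 0 → SemiProd φ)).contDiff.comp α.2.1

theorem zeroFormFun_mul (α : invForms Γ 0) {γ : SemiProd φ} (hγ : γ ∈ Γ) (x : SemiProd φ) :
    zeroFormFun α (γ * x) = zeroFormFun α x := by
  have h := DFunLike.congr_fun (α.2.2 γ hγ x) ![]
  rw [ContinuousAlternatingMap.compContinuousLinearMap_apply,
    Subsingleton.elim (_ ∘ ![]) ![]] at h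
  exact h

theorem toCovector_invExtDeriv (α : invForms Γ 0) (x u : SemiProd φ) :
    toCovector ((invExtDeriv Γ 0 α).1 x) u = fderiv ℝ (zeroFormFun α) x u :=
  extDeriv_zeroForm_apply α.2.1 u

theorem oneForm_eq_zero {θ : invForms Γ 1} (h : ∀ x v, toCovector (θ.1 x) v = 0) : θ = 0 := by
  refine Subtype.ext (funext fun x => ?_)
  ext w
  rw [toCovector_apply, h]
  rfl

theorem toCovector_add {E : Type} [NormedAddCommGroup E] [NormedSpace ℝ E]
    (θ η : E [⋀^Fin 1]→L[ℝ] ℝ) (v : E) :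
    toCovector (θ + η) v = toCovector θ v + toCovector η v := rfl

/-- Left-invariant forms are in particular `Γ`-invariant. -/
def invFormsInclusion (Γ : Subgroup (SemiProd φ)) (k : ℕ) :
    invForms (⊤ : Subgroup (SemiProd φ)) k →ₗ[ℝ] invForms Γ k :=
  Submodule.inclusion fun _ hα => ⟨hα.1, fun γ _ => hα.2 γ (Subgroup.mem_top γ)⟩

theorem invExtDeriv_invFormsInclusion (k : ℕ) (α : invForms (⊤ : Subgroup (SemiProd φ)) k) :
    invExtDeriv Γ k (invFormsInclusion Γ k α) = invFormsInclusion Γ (k + 1) (invExtDeriv ⊤ k α) :=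
  rfl

end Invariant

/-! ### The first cohomology of left-invariant forms -/

/-- A left-invariant `1`-form which is the differential of a function `F` on `G/Γ` vanishes:
`F (h x) - F x` does not depend on `x`, so that `F (h ^ k) = F 1 + k (F h - F 1)` for all `k`, and
`F` is bounded by compactness. -/
theorem IsLattice.leftInvariant_eq_zero_of_exact {Γ : Subgroup (SemiProd φ)} (hΓ : IsLattice Γ)
    (θ : invForms (⊤ : Subgroup (SemiProd φ)) 1) (α : invForms Γ 0)
    (h : invFormsInclusion Γ 1 θ = invExtDeriv Γ 0 α) : θ = 0 := by
  have hFd : Differentiable ℝ (zeroFormFun α) := (contDiff_zeroFormFun α).differentiable (by simp)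
  have hF : ∀ x u, toCovector (θ.1 x) u = fderiv ℝ (zeroFormFun α) x u := fun x u => by
    rw [← toCovector_invExtDeriv, ← h]
    rfl
  have htrans : ∀ g x, zeroFormFun α (g * x) - zeroFormFun α x
      = zeroFormFun α g - zeroFormFun α 1 := by
    intro g x
    have hd : ∀ y, HasFDerivAt (fun y => zeroFormFun α (g * y) - zeroFormFun α y)
        ((fderiv ℝ (zeroFormFun α) (g * y)).comp (leftDeriv g y) - fderiv ℝ (zeroFormFun α) y) y :=
      fun y => ((hFd (g * y)).hasFDerivAt.comp y
        ((contDiff_leftMul g (r := 1)).differentiable one_ne_zero y).hasFDerivAt).sub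
          (hFd y).hasFDerivAt
    have hconst := is_const_of_fderiv_eq_zero (𝕜 := ℝ) (fun y => (hd y).differentiableAt)
      (fun y => by
        rw [(hd y).fderiv]
        ext u
        change fderiv ℝ (zeroFormFun α) (g * y) (leftDeriv g y u) - fderiv ℝ (zeroFormFun α) y u = 0
        rw [← hF, ← hF, toCovector_leftDeriv θ (Subgroup.mem_top g), sub_self]) x 1
    simpa only [mul_one] using hconst
  have hpow : ∀ (g : SemiProd φ) (k : ℕ), zeroFormFun α (g ^ k)
      = zeroFormFun α 1 + k * (zeroFormFun α g - zeroFormFun α 1) := by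
    intro g k
    induction k with
    | zero => simp
    | succ k ih =>
      have := htrans g (g ^ k)
      rw [pow_succ']
      push_cast
      linarith
  obtain ⟨C, hC⟩ := hΓ.exists_bound hFd.continuous fun γ hγ x => zeroFormFun_mul α hγ x
  have hconst : ∀ g, zeroFormFun α g = zeroFormFun α 1 := by
    intro g
    by_contra hne
    have hpos : 0 < |zeroFormFun α g - zeroFormFun α 1| := abs_pos.2 (sub_ne_zero.2 hne)
    obtain ⟨k, hk⟩ := exists_nat_gt (2 * C / |zeroFormFun α g - zeroFormFun α 1|)
    rw [div_lt_iff₀ hpos] at hk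
    have h₁ : (k : ℝ) * (zeroFormFun α g - zeroFormFun α 1)
        = zeroFormFun α (g ^ k) - zeroFormFun α 1 := by rw [hpow]; ring
    have h₂ : (k : ℝ) * |zeroFormFun α g - zeroFormFun α 1|
        = |zeroFormFun α (g ^ k) - zeroFormFun α 1| := by
      rw [← h₁, abs_mul, Nat.abs_cast]
    have h₃ := abs_sub (zeroFormFun α (g ^ k)) (zeroFormFun α 1)
    linarith [hC (g ^ k), hC 1]
  refine oneForm_eq_zero fun x v => ?_
  rw [hF, show zeroFormFun α = fun _ => zeroFormFun α 1 from funext hconst]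
  simp

/-- The left-invariant closed form `dxᵢ` given by the `i`-th coordinate of `ℝ^m`. -/
def coordForm (φ : Representation ℝ (Multiplicative (Fin m → ℝ)) (Fin n → ℝ)) (i : Fin m) :
    invForms (⊤ : Subgroup (SemiProd φ)) 1 :=
  ⟨fun _ => ContinuousAlternatingMap.ofSubsingleton ℝ (SemiProd φ) ℝ (0 : Fin 1)
      ((ContinuousLinearMap.proj i).comp (ContinuousLinearMap.fst ℝ (Fin m → ℝ) (Fin n → ℝ))),
    contDiff_const, fun γ _ x => by
      ext w
      change (leftDeriv γ x (w 0)).1 i = (w 0).1 i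
      rw [leftDeriv_apply]⟩

theorem coordForm_closed (i : Fin m) : invExtDeriv ⊤ 1 (coordForm φ i) = 0 := by
  refine Subtype.ext (funext fun x => ?_)
  have h : fderiv ℝ (coordForm φ i).1 x = 0 := fderiv_const_apply _
  exact (congrArg ContinuousAlternatingMap.alternatizeUncurryFin h).trans
    (map_zero (ContinuousAlternatingMap.alternatizeUncurryFinCLM ℝ (SemiProd φ) ℝ))

theorem coordForm_ne_zero (i : Fin m) : coordForm φ i ≠ 0 := by
  intro h
  have h₁ := congrArg (fun θ : invForms (⊤ : Subgroup (SemiProd φ)) 1 =>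
    toCovector (θ.1 1) (Pi.single i 1, 0)) h
  have h₂ : (Pi.single i (1 : ℝ) : Fin m → ℝ) i = 0 := h₁
  simp at h₂

instance finiteDimensional_leftInvariant :
    FiniteDimensional ℝ (invForms (⊤ : Subgroup (SemiProd φ)) 1) := by
  let ev : invForms (⊤ : Subgroup (SemiProd φ)) 1 →ₗ[ℝ] (SemiProd φ →L[ℝ] ℝ) :=
    { toFun := fun θ => toCovector (θ.1 1)
      map_add' := fun _ _ => rfl
      map_smul' := fun _ _ => rfl }
  refine Module.Finite.of_injective ev ?_
  rw [injective_iff_map_eq_zero]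
  intro θ hθ
  refine oneForm_eq_zero fun x v => ?_
  rw [← toCovector_leftDeriv θ (Subgroup.mem_top x⁻¹), inv_mul_cancel]
  exact DFunLike.congr_fun hθ _

/-- If `b₁(G/Γ) = b₁(𝔤)`, then every closed `1`-form on `G/Γ` is cohomologous to a left-invariant
one. Closed left-invariant forms inject into `H¹(G/Γ)`, and the two dimensions agree; the number
`b₁(𝔤)` is positive, so that `H¹(G/Γ)` cannot have dimension zero for being infinite-dimensional. -/
theorem IsLattice.exists_leftInvariant_cohomologous {Γ : Subgroup (SemiProd φ)} (hΓ : IsLattice Γ)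
    (hm : 0 < m) (hb : bettiOne Γ = bettiOne (⊤ : Subgroup (SemiProd φ))) {θ : invForms Γ 1}
    (hθ : invExtDeriv Γ 1 θ = 0) :
    ∃ θ₀ : invForms (⊤ : Subgroup (SemiProd φ)) 1, invExtDeriv ⊤ 1 θ₀ = 0 ∧
      ∃ α : invForms Γ 0, θ = invFormsInclusion Γ 1 θ₀ + invExtDeriv Γ 0 α := by
  let Z := LinearMap.ker (invExtDeriv (⊤ : Subgroup (SemiProd φ)) 1)
  let ZΓ := LinearMap.ker (invExtDeriv Γ 1)
  let BΓ := (LinearMap.range (invExtDeriv Γ 0)).submoduleOf ZΓ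
  let i : Z →ₗ[ℝ] ZΓ := (invFormsInclusion Γ 1).restrict fun ζ hζ => by
    have h : invExtDeriv ⊤ 1 ζ = 0 := LinearMap.mem_ker.1 hζ
    rw [LinearMap.mem_ker, invExtDeriv_invFormsInclusion, h, map_zero]
  let q : Z →ₗ[ℝ] ZΓ ⧸ BΓ := BΓ.mkQ.comp i
  have hq : Function.Injective q := by
    rw [injective_iff_map_eq_zero]
    intro ζ hζ
    obtain ⟨α, hα⟩ := (Submodule.Quotient.mk_eq_zero BΓ).1 hζ
    exact Subtype.ext (hΓ.leftInvariant_eq_zero_of_exact ζ.1 α hα.symm)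
  have hB : (LinearMap.range (invExtDeriv (⊤ : Subgroup (SemiProd φ)) 0)).submoduleOf Z = ⊥ := by
    rw [eq_bot_iff]
    rintro ζ ⟨α, hα⟩
    refine (Submodule.mem_bot ℝ).2 (Subtype.ext ?_)
    refine hΓ.leftInvariant_eq_zero_of_exact ζ.1 (invFormsInclusion Γ 0 α) ?_
    exact Subtype.ext (congrArg Subtype.val hα).symm
  have hZ : bettiOne (⊤ : Subgroup (SemiProd φ)) = Module.finrank ℝ Z :=
    (Submodule.quotEquivOfEqBot _ hB).finrank_eq
  have hpos : 0 < Module.finrank ℝ Z := by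
    have : Nontrivial Z := ⟨⟨⟨coordForm φ ⟨0, hm⟩, coordForm_closed _⟩, 0, fun h =>
      coordForm_ne_zero (φ := φ) ⟨0, hm⟩ (congrArg Subtype.val h)⟩⟩
    exact Module.finrank_pos
  have hdim : Module.finrank ℝ (ZΓ ⧸ BΓ) = Module.finrank ℝ Z := hb.trans hZ
  have : Module.Finite ℝ (ZΓ ⧸ BΓ) := Module.finite_of_finrank_pos (hdim ▸ hpos)
  have hsurj := (LinearMap.injective_iff_surjective_of_finrank_eq_finrank hdim.symm).1 hq
  obtain ⟨ζ, hζ⟩ := hsurj (BΓ.mkQ ⟨θ, LinearMap.mem_ker.2 hθ⟩)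
  obtain ⟨α, hα⟩ := (Submodule.Quotient.eq BΓ).1 hζ.symm
  refine ⟨ζ.1, LinearMap.mem_ker.1 ζ.2, α, ?_⟩
  rw [hα]
  change θ = invFormsInclusion Γ 1 ζ.1 + (θ - invFormsInclusion Γ 1 ζ.1)
  abel

/-- A closed left-invariant `1`-form `θ` vanishes on `[G, G]`. By closedness `θ` at `(a, 0)` has the
same restriction to `ℝ^n` as at the identity, while by invariance the two restrictions differ by
`φ(a)`; so this restriction is `φ`-invariant, hence kills all `φ(a) b - b`. -/
theorem toCovector_commutatorSubspace {θ : invForms (⊤ : Subgroup (SemiProd φ)) 1}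
    (hθ : invExtDeriv ⊤ 1 θ = 0) {v : SemiProd φ} (hv : v ∈ commutatorSubspace φ) :
    toCovector (θ.1 1) v = 0 := by
  set t : SemiProd φ → SemiProd φ →L[ℝ] ℝ := fun y => toCovector (θ.1 y) with ht
  have htd : Differentiable ℝ t := (contDiff_toCovector θ.2.1).differentiable (by simp)
  have hinv : ∀ x v, t x (leftDeriv x 1 v) = t 1 v := fun x v => by
    have := toCovector_leftDeriv θ (Subgroup.mem_top x) 1 v
    rwa [mul_one] at this
  let ι₁ : (Fin m → ℝ) →L[ℝ] SemiProd φ := ContinuousLinearMap.inl ℝ (Fin m → ℝ) (Fin n → ℝ)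
  let ι₂ : (Fin n → ℝ) →L[ℝ] SemiProd φ := ContinuousLinearMap.inr ℝ (Fin m → ℝ) (Fin n → ℝ)
  have happ : ∀ w x u, fderiv ℝ (fun y => t y w) x u = fderiv ℝ t x u w := fun w x u => by
    rw [fderiv_clm_apply (htd x) (differentiableAt_const w)]
    simp
  have h₁ : ∀ x u, t x (ι₁ u) = t 1 (ι₁ u) := fun x u => by
    rw [← hinv x (ι₁ u), leftDeriv_apply]
    congr 1
    exact Prod.ext rfl (map_zero _).symm
  have h₂ : ∀ x u w, fderiv ℝ t x (ι₁ u) (ι₂ w) = 0 := fun x u w => by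
    rw [fderiv_toCovector_symm hθ, ← happ, show (fun y => t y (ι₁ u)) = fun _ => t 1 (ι₁ u) from
      funext fun y => h₁ y u]
    simp
  have h₃ : ∀ a w, t (ι₁ a) (ι₂ w) = t 1 (ι₂ w) := by
    intro a w
    have hd : ∀ a, HasFDerivAt (fun a => t (ι₁ a) (ι₂ w))
        ((fderiv ℝ (fun y => t y (ι₂ w)) (ι₁ a)).comp ι₁) a := fun a =>
      ((htd _).clm_apply (differentiableAt_const _)).hasFDerivAt.comp a ι₁.hasFDerivAt
    have := is_const_of_fderiv_eq_zero (𝕜 := ℝ) (fun a => (hd a).differentiableAt) (fun a => by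
      rw [(hd a).fderiv]
      ext u
      change fderiv ℝ (fun y => t y (ι₂ w)) (ι₁ a) (ι₁ u) = 0
      rw [happ, h₂]) a 0
    exact this.trans (by rw [map_zero]; rfl)
  let L : (Fin n → ℝ) →L[ℝ] ℝ := (t 1).comp ι₂
  have h₄ : ∀ a w, L (φ (.ofAdd a) w) = L w := fun a w => by
    change t 1 (ι₂ (φ (.ofAdd a) w)) = t 1 (ι₂ w)
    rw [← h₃ a, ← hinv (ι₁ a) (ι₂ w), leftDeriv_apply]
    rfl
  have hcomm : ∀ a c b d, L (b + φ (.ofAdd a) d - φ (.ofAdd c) b - d) = 0 := fun a c b d => by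
    simp only [map_sub, map_add, h₄]
    ring
  have hmem : ∀ x ∈ commutator (SemiProd φ), L x.2 = 0 := by
    intro x hx
    rw [commutator_eq_closure] at hx
    induction hx using Subgroup.closure_induction with
    | mem x hx =>
      obtain ⟨p, q, rfl⟩ := hx
      exact (congrArg L (commutator_snd p q)).trans (hcomm _ _ _ _)
    | one => exact map_zero L
    | mul x y _ _ hx hy =>
      refine (map_add L x.2 (φ (.ofAdd x.1) y.2)).trans ?_
      rw [h₄, hx, hy, add_zero]
    | inv x _ hx =>
      refine (map_neg L (φ (.ofAdd (-x.1)) x.2)).trans ?_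
      rw [h₄, hx, neg_zero]
  have hv' : v = ι₂ v.2 := SemiProd.ext (commutator_aux 1 hv).1 rfl
  rw [hv']
  exact hmem v hv

/-! ### Vaisman metrics in the global chart -/

namespace LeftInvariantComplexStructure

variable (J : LeftInvariantComplexStructure φ)

theorem fderiv_J_J (x w v : SemiProd φ) :
    fderiv ℝ J.J x w (J.J x v) = -J.J x (fderiv ℝ J.J x w v) := by
  have hd := (J.contDiff_J.differentiable (by simp) x).hasFDerivAt
  have h := hd.clm_apply (hd.clm_apply (hasFDerivAt_const v x))
  rw [show (fun y => J.J y (J.J y v)) = fun _ => -v from funext fun y => J.J_J y v] at h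
  have := DFunLike.congr_fun (h.unique (hasFDerivAt_const (-v) x)) w
  simp only [add_apply, ContinuousLinearMap.comp_apply, ContinuousLinearMap.flip_apply,
    zero_apply, map_zero, zero_add] at this
  exact eq_neg_of_add_eq_zero_right this

end LeftInvariantComplexStructure

namespace HermitianMetric

variable {Γ : Subgroup (SemiProd φ)} {J : LeftInvariantComplexStructure φ}
  (h : HermitianMetric Γ J)

theorem hasFDerivAt_apply (x u v : SemiProd φ) : HasFDerivAt (fun y => h.g y u v)
    (((ContinuousLinearMap.apply ℝ ℝ v).comp
      (ContinuousLinearMap.apply ℝ (SemiProd φ →L[ℝ] ℝ) u)).comp (fderiv ℝ h.g x)) x := by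
  have hg := (h.contDiff_g.differentiable (by simp) x).hasFDerivAt
  refine ((hg.clm_apply (hasFDerivAt_const u x)).clm_apply (hasFDerivAt_const v x)).congr_fderiv ?_
  ext w
  simp

theorem fderiv_hermitian (x w u v : SemiProd φ) :
    fderiv ℝ h.g x w (J.J x u) (J.J x v) + h.g x (fderiv ℝ J.J x w u) (J.J x v)
      + h.g x (J.J x u) (fderiv ℝ J.J x w v) = fderiv ℝ h.g x w u v := by
  have hJ := (J.contDiff_J.differentiable (by simp) x).hasFDerivAt
  have hg := (h.contDiff_g.differentiable (by simp) x).hasFDerivAt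
  have h₁ := (hg.clm_apply (hJ.clm_apply (hasFDerivAt_const u x))).clm_apply
    (hJ.clm_apply (hasFDerivAt_const v x))
  rw [show (fun y => h.g y (J.J y u) (J.J y v)) = fun y => h.g y u v from
    funext fun y => h.hermitian y u v] at h₁
  have h₂ := DFunLike.congr_fun (h₁.unique (h.hasFDerivAt_apply x u v)) w
  simp only [add_apply, ContinuousLinearMap.comp_apply, ContinuousLinearMap.flip_apply,
    zero_apply, map_zero, zero_add, ContinuousLinearMap.apply_apply] at h₂
  linarith

theorem contDiff_fundamentalForm : ContDiff ℝ ∞ h.fundamentalForm := by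
  -- `ω` is half the alternatization of the smooth bilinear form `b(u, v) = g(u, J v)`
  let b : SemiProd φ → SemiProd φ →L[ℝ] SemiProd φ →L[ℝ] ℝ := fun x =>
    ((ContinuousLinearMap.compL ℝ (SemiProd φ) (SemiProd φ) ℝ).flip (J.J x)).comp (h.g x)
  have hb : ContDiff ℝ ∞ b := by
    have hJ : ContDiff ℝ ∞ fun x =>
        (ContinuousLinearMap.compL ℝ (SemiProd φ) (SemiProd φ) ℝ).flip (J.J x) :=
      (ContinuousLinearMap.contDiff _).comp J.contDiff_J
    exact hJ.clm_comp h.contDiff_g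
  let e : (SemiProd φ →L[ℝ] ℝ) →L[ℝ] (SemiProd φ) [⋀^Fin 1]→L[ℝ] ℝ :=
    (ContinuousAlternatingMap.ofSubsingletonLIE (𝕜 := ℝ) (E := SemiProd φ) (F := ℝ)
      (0 : Fin 1)).toContinuousLinearEquiv
  have heq : h.fundamentalForm = fun x => (1 / 2 : ℝ) •
      ContinuousAlternatingMap.alternatizeUncurryFinCLM ℝ (SemiProd φ) ℝ (e.comp (b x)) := by
    funext x
    ext v
    have hanti : h.g x (v 1) (J.J x (v 0)) = -h.g x (v 0) (J.J x (v 1)) := by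
      rw [← h.hermitian x (v 1), J.J_J, map_neg, h.symm]
    have h₁ : ContinuousAlternatingMap.alternatizeUncurryFin (e.comp (b x)) v
        = h.g x (v 0) (J.J x (v 1)) - h.g x (v 1) (J.J x (v 0)) := by
      rw [ContinuousAlternatingMap.alternatizeUncurryFin_apply, Fin.sum_univ_two]
      change (-1 : ℤ) ^ 0 • h.g x (v 0) (J.J x (v 1)) + (-1 : ℤ) ^ 1 • h.g x (v 1) (J.J x (v 0)) = _
      simp [sub_eq_add_neg]
    change h.g x (v 0) (J.J x (v 1))
      = (1 / 2 : ℝ) * ContinuousAlternatingMap.alternatizeUncurryFin (e.comp (b x)) v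
    rw [h₁, hanti]
    ring
  rw [heq]
  exact ((ContinuousLinearMap.contDiff _).comp (contDiff_const.clm_comp hb)).const_smul _

theorem extDeriv_fundamentalForm_apply (x a b c : SemiProd φ) :
    extDeriv h.fundamentalForm x ![a, b, c]
      = (fderiv ℝ h.g x a b (J.J x c) + h.g x b (fderiv ℝ J.J x a c))
        - (fderiv ℝ h.g x b a (J.J x c) + h.g x a (fderiv ℝ J.J x b c))
        + (fderiv ℝ h.g x c a (J.J x b) + h.g x a (fderiv ℝ J.J x c b)) := by
  have hω : ∀ u v w, fderiv ℝ (fun y => h.g y u (J.J y v)) x w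
      = fderiv ℝ h.g x w u (J.J x v) + h.g x u (fderiv ℝ J.J x w v) := by
    intro u v w
    have hJ := (J.contDiff_J.differentiable (by simp) x).hasFDerivAt
    have hg := (h.contDiff_g.differentiable (by simp) x).hasFDerivAt
    rw [((hg.clm_apply (hasFDerivAt_const u x)).clm_apply
      (hJ.clm_apply (hasFDerivAt_const v x))).fderiv]
    simp only [add_apply, ContinuousLinearMap.comp_apply, ContinuousLinearMap.flip_apply,
      zero_apply, map_zero, zero_add]
    ring
  rw [extDeriv_apply (h.contDiff_fundamentalForm.differentiable (by simp) x), Fin.sum_univ_three]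
  change (-1 : ℤ) ^ 0 • fderiv ℝ (fun y => h.g y b (J.J y c)) x a
    + (-1 : ℤ) ^ 1 • fderiv ℝ (fun y => h.g y a (J.J y c)) x b
    + (-1 : ℤ) ^ 2 • fderiv ℝ (fun y => h.g y a (J.J y b)) x c = _
  rw [hω, hω, hω]
  simp
  ring

/-- The metric dual `θ^♯` of a `1`-form; for the Lee form, the Lee field. -/
def sharp (θ : invForms Γ 1) (x : SemiProd φ) : SemiProd φ := (h.g x).inverse (toCovector (θ.1 x))

theorem g_sharp (θ : invForms Γ 1) (x : SemiProd φ) :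
    h.g x (h.sharp θ x) = toCovector (θ.1 x) :=
  metric_inverse (h.pos x) _

theorem contDiff_sharp (θ : invForms Γ 1) : ContDiff ℝ ∞ (h.sharp θ) := by
  have hinv : ∀ x, (h.g x).IsInvertible := fun x => by
    have hker : LinearMap.ker (h.g x).toLinearMap = ⊥ := by
      refine LinearMap.ker_eq_bot'.2 fun v hv => ?_
      by_contra hne
      have h₁ := h.pos x v hne
      rw [show h.g x v = 0 from hv] at h₁
      exact lt_irrefl _ h₁
    have hrange : LinearMap.range (h.g x).toLinearMap = ⊤ :=
      LinearMap.range_eq_top.2 fun ξ => ⟨_, metric_inverse (h.pos x) ξ⟩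
    exact ⟨ContinuousLinearEquiv.ofBijective (h.g x) hker hrange, rfl⟩
  rw [contDiff_iff_contDiffAt]
  intro x
  exact ((hinv x).contDiffAt_map_inverse.comp x h.contDiff_g.contDiffAt).clm_apply
    (contDiff_toCovector θ.2.1).contDiffAt

/-- The condition `∇θ = 0` for a `1`-form on `G/Γ`, where `∇` is the Levi-Civita connection. -/
def IsParallel (θ : invForms Γ 1) : Prop :=
  ∀ X Y : SemiProd φ → SemiProd φ, ContDiff ℝ ∞ X → ContDiff ℝ ∞ Y → ∀ x,
    fderiv ℝ (fun y => toCovector (θ.1 y) (Y y)) x (X x)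
      - toCovector (θ.1 x) (leviCivita h.g X Y x) = 0

variable {h} {θ : invForms Γ 1}

/-- A parallel `1`-form has constant length: with `A = θ^♯`, compatibility of `∇` with the metric
gives `X(g(A, A)) = 2 θ(∇_X A)`, and `∇θ = 0` gives `X(θ(A)) = θ(∇_X A)`. -/
theorem IsParallel.norm_sq_eq (hθ : h.IsParallel θ) (x y : SemiProd φ) :
    toCovector (θ.1 x) (h.sharp θ x) = toCovector (θ.1 y) (h.sharp θ y) := by
  have hA := h.contDiff_sharp θ
  have hAd := hA.differentiable (by simp)
  have hgd := h.contDiff_g.differentiable (by simp)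
  have hd : Differentiable ℝ fun y => toCovector (θ.1 y) (h.sharp θ y) :=
    ((contDiff_toCovector θ.2.1).differentiable (by simp)).clm_apply hAd
  refine is_const_of_fderiv_eq_zero (𝕜 := ℝ) hd (fun z => ?_) x y
  ext u
  have h₁ := leviCivita_metric hgd h.symm h.pos (fun _ => u) hAd hAd z
  have h₂ := hθ (fun _ => u) (h.sharp θ) contDiff_const hA z
  rw [h.symm z (leviCivita _ _ _ _), g_sharp] at h₁
  simp only [g_sharp] at h₁
  simp only [zero_apply]
  linarith

theorem norm_sq_pos {x : SemiProd φ} (hx : toCovector (θ.1 x) ≠ 0) :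
    0 < toCovector (θ.1 x) (h.sharp θ x) := by
  rw [← h.g_sharp θ]
  refine h.pos x _ fun h0 => hx ?_
  rw [← h.g_sharp θ, h0, map_zero]

theorem IsParallel.fderiv_eq (hθ : h.IsParallel θ) (x u v : SemiProd φ) :
    fderiv ℝ (fun y => toCovector (θ.1 y)) x u v
      = (1 / 2) * (fderiv ℝ h.g x u v (h.sharp θ x) + fderiv ℝ h.g x v u (h.sharp θ x)
        - fderiv ℝ h.g x (h.sharp θ x) u v) := by
  have h₁ := hθ (fun _ => u) (fun _ => v) contDiff_const contDiff_const x
  have hd := (contDiff_toCovector θ.2.1).differentiable (by simp) x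
  rw [fderiv_clm_apply hd (differentiableAt_const v), leviCivita, fderiv_const_apply, ← g_sharp h,
    zero_apply, zero_add, h.symm, metric_inverse (h.pos x)] at h₁
  simp only [christoffelLower, smul_apply, sub_apply, add_apply, ContinuousLinearMap.comp_apply,
    ContinuousLinearMap.apply_apply, ContinuousLinearMap.flip_apply, smul_eq_mul,
    zero_apply, map_zero, zero_add] at h₁
  linarith

/-- The divergence of a parallel Lee form `θ` along a `J`-holomorphic curve through `x` with tangent
vectors `V` and `W = J V` which is affine in the global chart. In `dω = θ ∧ ω`, evaluated at
`(θ^♯, V, W)`, the left-hand side is exactly this divergence. -/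
theorem IsParallel.fderiv_add_fderiv (hθ : h.IsParallel θ) (hL : h.IsLeeForm θ) {x V W : SemiProd φ}
    (hV : J.J x V = W) (hVV : fderiv ℝ J.J x V V = 0) (hWV : fderiv ℝ J.J x W V = 0) :
    fderiv ℝ (fun y => toCovector (θ.1 y)) x V V + fderiv ℝ (fun y => toCovector (θ.1 y)) x W W
      = toCovector (θ.1 x) V ^ 2 + toCovector (θ.1 x) W ^ 2
        - toCovector (θ.1 x) (h.sharp θ x) * h.g x V V := by
  set A := h.sharp θ x with hA
  have hW : J.J x W = -V := by rw [← hV, J.J_J]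
  have hVW : fderiv ℝ J.J x V W = 0 := by
    rw [← hV, J.fderiv_J_J, hVV, map_zero, neg_zero]
  have hgd := h.contDiff_g.differentiable (by simp)
  have hLee := DFunLike.congr_fun (hL.extDeriv_eq x) ![A, V, W]
  rw [extDeriv_fundamentalForm_apply, wedgeOne_apply, Fin.sum_univ_three] at hLee
  have hω : ∀ a b c : SemiProd φ,
      (h.fundamentalForm x ((0 : Fin 3).removeNth ![a, b, c]) = h.g x b (J.J x c)) ∧
      (h.fundamentalForm x ((1 : Fin 3).removeNth ![a, b, c]) = h.g x a (J.J x c)) ∧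
      (h.fundamentalForm x ((2 : Fin 3).removeNth ![a, b, c]) = h.g x a (J.J x b)) :=
    fun a b c => ⟨rfl, rfl, rfl⟩
  rw [(hω A V W).1, (hω A V W).2.1, (hω A V W).2.2] at hLee
  simp only [toCovector_apply, hV, hW, hVW, hWV, map_neg, map_zero] at hLee
  -- the derivative of `J` in the direction `A` is controlled by that of `g`, as `J` is orthogonal
  have hherm := h.fderiv_hermitian x A V V
  have hJA : h.g x V (fderiv ℝ J.J x A W) = h.g x W (fderiv ℝ J.J x A V) := by
    rw [← hV, J.fderiv_J_J, ← h.hermitian x V, map_neg, J.J_J, neg_neg]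
  rw [hV, h.symm x (fderiv ℝ J.J x A V)] at hherm
  have hs₁ := fderiv_metric_symm hgd h.symm x V A V
  have hs₂ := fderiv_metric_symm hgd h.symm x W A W
  have hgA : ∀ u, h.g x A u = toCovector (θ.1 x) u := fun u => by rw [hA, g_sharp]
  rw [hJA, hgA, hgA, hs₁, hs₂] at hLee
  rw [hθ.fderiv_eq, hθ.fderiv_eq, ← hA]
  simp at hLee
  linarith

end HermitianMetric

/-! ### A complex line in `[𝔤, 𝔤]` and the contradiction -/

/-- If `dim [G, G] > dim G / 2`, then `[𝔤, 𝔤]` contains a complex line. -/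
theorem exists_mem_commutatorSubspace_J_mem (J : LeftInvariantComplexStructure φ)
    (hdim : (Module.finrank ℝ (SemiProd φ) : ℝ) / 2 < Module.finrank ℝ (commutatorSubspace φ)) :
    ∃ v ∈ commutatorSubspace φ, v ≠ 0 ∧ J.J 1 v ∈ commutatorSubspace φ := by
  have hJ : Function.Injective (J.J 1).toLinearMap := fun v w hvw => by
    have h : J.J 1 v = J.J 1 w := hvw
    rw [← neg_inj, ← J.J_J 1 v, h, J.J_J]
  have hrank : Module.finrank ℝ ((commutatorSubspace φ).map (J.J 1).toLinearMap)
      = Module.finrank ℝ (commutatorSubspace φ) :=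
    (Submodule.equivMapOfInjective _ hJ _).finrank_eq.symm
  have hnd : ¬ Disjoint (commutatorSubspace φ)
      ((commutatorSubspace φ).map (J.J 1).toLinearMap) := by
    intro hd
    have h₁ := Submodule.finrank_add_finrank_le_of_disjoint hd
    rw [hrank] at h₁
    have h₂ : (Module.finrank ℝ (commutatorSubspace φ) : ℝ)
      + Module.finrank ℝ (commutatorSubspace φ) ≤ Module.finrank ℝ (SemiProd φ) := by
      exact_mod_cast h₁
    linarith
  rw [Submodule.disjoint_def] at hnd
  push Not at hnd
  obtain ⟨_, hu, ⟨v, hv, rfl⟩, hne⟩ := hnd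
  exact ⟨v, hv, fun h0 => hne (by rw [h0, map_zero]), hu⟩

theorem leftDeriv_of_fst_eq_zero {p : SemiProd φ} (hp : p.1 = 0) (x v : SemiProd φ) :
    leftDeriv p x v = v := by
  rw [leftDeriv_apply, hp]
  exact Prod.ext rfl (act_zero _)

/-- A nontrivial commutator forces `0 < m`; hence `dx₁` is a nonzero class in `H¹(𝔤)`. -/
theorem pos_of_commutatorSubspace_ne_zero {v : SemiProd φ} (hv : v ∈ commutatorSubspace φ)
    (hne : v ≠ 0) : 0 < m := by
  rcases Nat.eq_zero_or_pos m with rfl | hm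
  · exfalso
    -- for `m = 0` the group `G` is abelian
    have hcomm : ∀ p q : SemiProd φ, p * q = q * p := fun p q => by
      have hp : ∀ r : SemiProd φ, r.1 = 0 := fun r => Subsingleton.elim _ _
      refine SemiProd.ext (Subsingleton.elim _ _) ?_
      rw [mul_snd, mul_snd, hp p, hp q, act_zero, act_zero, add_comm]
    have hbot : commutator (SemiProd φ) = ⊥ := by
      rw [commutator_def, Subgroup.commutator_eq_bot_iff_le_centralizer]
      exact fun p _ => Subgroup.mem_centralizer_iff.2 fun q _ => hcomm q p
    have hv' : v ∈ commutator (SemiProd φ) := hv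
    rw [hbot] at hv'
    exact hne (Subgroup.mem_bot.1 hv')
  · exact hm

namespace HermitianMetric

variable {Γ : Subgroup (SemiProd φ)} {J : LeftInvariantComplexStructure φ} {h : HermitianMetric Γ J}

/-- If `[𝔤, 𝔤]` contains a complex line, then a Lee form `θ` on `G/Γ` which is cohomologous to a
left-invariant form is not parallel. On the plane `P` through the identity spanned by the line,
`θ = df` for a function `f` on `G/Γ`; were `θ` parallel, the vector field on `P` with components
`-e^{-f} θ(v)` and `-e^{-f} θ(J v)` would be bounded with divergence `e^{-f} |θ|² |v|²`, which is
bounded below by compactness of `G/Γ`. -/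
theorem IsLeeForm.not_isParallel (hΓ : IsLattice Γ)
    (hφ : ContDiff ℝ ∞ fun p : (Fin m → ℝ) × (Fin n → ℝ) => φ (.ofAdd p.1) p.2)
    {θ : invForms Γ 1} (hL : h.IsLeeForm θ)
    {v : SemiProd φ} (hv : v ∈ commutatorSubspace φ) (hJv : J.J 1 v ∈ commutatorSubspace φ)
    (hne : v ≠ 0) {θ₀ : invForms (⊤ : Subgroup (SemiProd φ)) 1} (hθ₀ : invExtDeriv ⊤ 1 θ₀ = 0)
    {α : invForms Γ 0} (hα : θ = invFormsInclusion Γ 1 θ₀ + invExtDeriv Γ 0 α) :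
    ¬ h.IsParallel θ := by
  intro hpar
  set w := J.J 1 v with hw
  set t : SemiProd φ → SemiProd φ →L[ℝ] ℝ := fun y => toCovector (θ.1 y) with ht
  set f := zeroFormFun α with hf
  have htC : ContDiff ℝ ∞ t := contDiff_toCovector θ.2.1
  have hfC : ContDiff ℝ ∞ f := contDiff_zeroFormFun α
  -- the squared length of the Lee form is a positive constant
  obtain ⟨c, hc, hc'⟩ : ∃ c, 0 < c ∧ ∀ x, t x (h.sharp θ x) = c := by
    obtain ⟨x, hx⟩ : ∃ x, t x ≠ 0 := by
      by_contra! hall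
      refine hL.not_exact ?_
      rw [oneForm_eq_zero (θ := θ) fun x u => by
        change t x u = 0
        rw [hall x, zero_apply]]
      exact zero_mem _
    exact ⟨_, norm_sq_pos hx, fun y => hpar.norm_sq_eq y x⟩
  have hleft : ∀ u : SemiProd φ, Continuous fun p => leftDeriv p 1 u :=
    continuous_leftDeriv hφ 1
  have hmul : ∀ γ p u : SemiProd φ, leftDeriv (γ * p) 1 u = leftDeriv γ p (leftDeriv p 1 u) :=
    fun γ p u => (leftDeriv_mul γ p 1 p 1 u).symm
  obtain ⟨Mv, hMv⟩ := hΓ.exists_bound (F := fun p => -(Real.exp (-f p) * t p (leftDeriv p 1 v)))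
    ((hfC.continuous.neg.rexp.mul (htC.continuous.clm_apply (hleft v))).neg) (fun γ hγ p => by
      simp only [hf, ht, zeroFormFun_mul α hγ, hmul, toCovector_leftDeriv θ hγ])
  obtain ⟨Mw, hMw⟩ := hΓ.exists_bound (F := fun p => -(Real.exp (-f p) * t p (leftDeriv p 1 w)))
    ((hfC.continuous.neg.rexp.mul (htC.continuous.clm_apply (hleft w))).neg) (fun γ hγ p => by
      simp only [hf, ht, zeroFormFun_mul α hγ, hmul, toCovector_leftDeriv θ hγ])
  -- the divergence is bounded below because its inverse is bounded
  have hdpos : ∀ p, 0 < Real.exp (-f p) * (c * h.g p (leftDeriv p 1 v) (leftDeriv p 1 v)) :=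
    fun p => mul_pos (Real.exp_pos _) (mul_pos hc (h.pos p _ fun h0 =>
      hne (leftDeriv_injective p 1 (h0.trans (map_zero _).symm))))
  obtain ⟨C, hC⟩ := hΓ.exists_bound
    (F := fun p => (Real.exp (-f p) * (c * h.g p (leftDeriv p 1 v) (leftDeriv p 1 v)))⁻¹)
    (Continuous.inv₀ (hfC.continuous.neg.rexp.mul (continuous_const.mul
      ((h.contDiff_g.continuous.clm_apply (hleft v)).clm_apply (hleft v))))
      fun p => (hdpos p).ne') (fun γ hγ p => by
      simp only [hf, zeroFormFun_mul α hγ, hmul, h.invariant γ hγ])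
  have hCpos : 0 < C := (inv_pos.2 (hdpos 1)).trans_le ((le_abs_self _).trans (hC 1))
  -- the plane through the identity
  let ℓ : ℝ × ℝ →L[ℝ] SemiProd φ :=
    (ContinuousLinearMap.fst ℝ ℝ ℝ).smulRight v + (ContinuousLinearMap.snd ℝ ℝ ℝ).smulRight w
  have hℓ : ∀ z, ℓ z = z.1 • v + z.2 • w := fun z => rfl
  have hℓv : ℓ (1, 0) = v := by simp [hℓ]
  have hℓw : ℓ (0, 1) = w := by simp [hℓ]
  have hmem : ∀ z, ℓ z ∈ commutatorSubspace φ := fun z => by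
    rw [hℓ]
    exact add_mem (Submodule.smul_mem _ _ hv) (Submodule.smul_mem _ _ hJv)
  have hfst : ∀ z, (ℓ z).1 = 0 := fun z => (commutator_aux 1 (hmem z)).1
  have hconst : ∀ z u, leftDeriv (ℓ z) 1 u = u := fun z u => leftDeriv_of_fst_eq_zero (hfst z) 1 u
  have hJℓ : ∀ z, J.J (ℓ z) v = w := fun z => by
    have h₁ := J.left_invariant (ℓ z) 1 v
    rwa [mul_one, hconst, ← hw, hconst] at h₁
  have hdJ : ∀ z a, fderiv ℝ J.J (ℓ z) (ℓ a) v = 0 := fun z a => by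
    have h₁ := (((J.contDiff_J.differentiable (by simp) (ℓ z)).hasFDerivAt.comp z
      ℓ.hasFDerivAt).clm_apply (hasFDerivAt_const v z))
    have h₂ : (fun y => (J.J ∘ ℓ) y v) = fun _ => w := funext hJℓ
    rw [h₂] at h₁
    simpa using DFunLike.congr_fun (h₁.unique (hasFDerivAt_const w z)) a
  -- `θ = df` along the plane, as `θ₀` vanishes on `[𝔤, 𝔤]`
  have htf : ∀ z, ∀ u ∈ commutatorSubspace φ, t (ℓ z) u = fderiv ℝ f (ℓ z) u := fun z u hu => by
    have h₁ := toCovector_leftDeriv θ₀ (Subgroup.mem_top (ℓ z)) 1 u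
    rw [mul_one, hconst, toCovector_commutatorSubspace hθ₀ hu] at h₁
    have h₂ : t (ℓ z) u = toCovector (θ₀.1 (ℓ z)) u
        + toCovector ((invExtDeriv Γ 0 α).1 (ℓ z)) u := by
      rw [← toCovector_add, ht, hα]
      rfl
    rw [h₂, h₁, zero_add, toCovector_invExtDeriv]
  have hP : ∀ u, ContDiff ℝ 1 fun z => -(Real.exp (-f (ℓ z)) * t (ℓ z) u) := fun u =>
    (((hfC.comp ℓ.contDiff).neg.exp.mul
      ((htC.comp ℓ.contDiff).clm_apply contDiff_const)).neg).of_le (by norm_cast)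
  have hdP : ∀ u ∈ commutatorSubspace φ, ∀ z a, ℓ a = u →
      fderiv ℝ (fun z => -(Real.exp (-f (ℓ z)) * t (ℓ z) u)) z a
        = Real.exp (-f (ℓ z)) * (t (ℓ z) u ^ 2 - fderiv ℝ t (ℓ z) u u) := by
    intro u hu z a ha
    have h₁ := ((hfC.differentiable (by simp) (ℓ z)).hasFDerivAt.comp z ℓ.hasFDerivAt).neg.exp
    have h₂ := ((htC.differentiable (by simp) (ℓ z)).hasFDerivAt.comp z
      ℓ.hasFDerivAt).clm_apply (hasFDerivAt_const u z)
    have h₃ := (h₁.mul h₂).neg.fderiv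
    refine (DFunLike.congr_fun h₃ a).trans ?_
    simp [ha]
    rw [← htf z u hu]
    ring
  refine not_forall_le_divergence (hP v) (hP w) (M := max Mv Mw) (inv_pos.2 hCpos)
    (fun z => ?_) (fun z => ?_) fun z => ?_
  · have h₁ := hMv (ℓ z)
    simp only [hconst] at h₁
    exact h₁.trans (le_max_left _ _)
  · have h₁ := hMw (ℓ z)
    simp only [hconst] at h₁
    exact h₁.trans (le_max_right _ _)
  · have hkey := hpar.fderiv_add_fderiv hL (hJℓ z) (by simpa [hℓv] using hdJ z (1, 0))
      (by simpa [hℓw] using hdJ z (0, 1))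
    rw [hdP v hv z _ hℓv, hdP w hJv z _ hℓw, ← mul_add]
    have hsum : t (ℓ z) v ^ 2 - fderiv ℝ t (ℓ z) v v + (t (ℓ z) w ^ 2 - fderiv ℝ t (ℓ z) w w)
        = c * h.g (ℓ z) v v := by
      rw [← hc' (ℓ z)]
      linarith
    rw [hsum]
    have h₁ := hC (ℓ z)
    have h₂ := hdpos (ℓ z)
    simp only [hconst] at h₁ h₂
    exact inv_le_of_inv_le₀ h₂ ((le_abs_self _).trans h₁)

end HermitianMetric

end SemiProd

end MetaAbelian

end

open MetaAbelian MetaAbelian.SemiProd in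
theorem mainTheorem2 (m n : ℕ)
    (φ : Representation ℝ (Multiplicative (Fin m → ℝ)) (Fin n → ℝ))
    (hφ : ContDiff ℝ ∞ fun p : (Fin m → ℝ) × (Fin n → ℝ) => φ (.ofAdd p.1) p.2)
    (hss : φ.IsSemisimpleRepresentation)
    (hdim : (Module.finrank ℝ (SemiProd φ) : ℝ) / 2 < Module.finrank ℝ (commutatorSubspace φ))
    (Γ : Subgroup (SemiProd φ)) (hΓ : IsLattice Γ)
    (J : LeftInvariantComplexStructure φ)
    (hb : bettiOne Γ = bettiOne (⊤ : Subgroup (SemiProd φ))) :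
    ¬ ∃ g : HermitianMetric Γ J, g.IsVaisman := by
  rintro ⟨g, θ, hL, hpar⟩
  obtain ⟨v, hv, hne, hJv⟩ := exists_mem_commutatorSubspace_J_mem J hdim
  obtain ⟨θ₀, hθ₀, α, hα⟩ := hΓ.exists_leftInvariant_cohomologous
    (pos_of_commutatorSubspace_ne_zero hv hne) hb hL.closed
  exact hL.not_isParallel hΓ hφ hv hJv hne hθ₀ hα hpar
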